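/- Let $\Gamma$ be a finite simplicial graph whose edges are labelled by integers greater than $1$. Let $A=A(\Gamma)$ be the Artin group of $\Gamma$: the group presented by one generator for each vertex of $\Gamma$ and, for each edge $\{a,b\}$ of $\Gamma$ with label $m$, the relation $\underbrace{abab\cdots}_{m\text{ factors}}=\underbrace{baba\cdots}_{m\text{ factors}}$. Then the following are equivalent: 1. $A$ is ERF (extended residually finite), that is, every subgroup of $A$ (finitely generated or not) is closed in the profinite topology of $A$, the topology which has the cosets of the finite index normal subgroups of $A$ as a basis; 2. $\Gamma$ is complete and all its edges are labelled by $2$; 3. $A$ is free abelian. -/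

import Mathlib

open scoped Pointwise

universe u

/-- A simplicial graph on the vertex type `V` whose edges are labelled by integers greater
than 1. -/
structure ArtinGraph (V : Type u) where
  /-- The underlying simplicial graph. -/
  graph : SimpleGraph V
  /-- The label of each edge. -/
  label : graph.EdgeLabeling ℕ
  one_lt_label : ∀ e, 1 < label e

/-- The alternating product `a b a b ⋯` with `m` factors, beginning with `a`. -/
def altProd {G : Type u} [Group G] (a b : G) : ℕ → G
  | 0 => 1
  | m + 1 => a * altProd b a m

namespace ArtinGraph

variable {V : Type u}

/-- The relators `(a b a ⋯)(b a b ⋯)⁻¹`, with `m` factors in each product, for each edge `{a, b}`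
of label `m`. -/
def relators (Γ : ArtinGraph V) : Set (FreeGroup V) :=
  {r | ∃ (a b : V) (h : Γ.graph.Adj a b),
    r = altProd (FreeGroup.of a) (FreeGroup.of b) (Γ.label.get a b h) *
      (altProd (FreeGroup.of b) (FreeGroup.of a) (Γ.label.get a b h))⁻¹}

/-- The Artin group `A(Γ)`. -/
abbrev ArtinGroup (Γ : ArtinGraph V) : Type u := PresentedGroup Γ.relators

/-- `Γ` is a complete graph and all its edges are labelled by 2. -/
def IsCompleteTwo (Γ : ArtinGraph V) : Prop :=
  Γ.graph = ⊤ ∧ ∀ e, Γ.label e = 2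

end ArtinGraph

/-- The family of cosets of finite index normal subgroups of `G`. -/
def finiteIndexNormalCosets (G : Type u) [Group G] : Set (Set G) :=
  {s | ∃ (N : Subgroup G) (g : G), N.Normal ∧ N.FiniteIndex ∧ s = g • (N : Set G)}

/-- The profinite topology on `G`: the one with the cosets of the finite index normal subgroups
as a basis. -/
@[reducible]
def profiniteTopology (G : Type u) [Group G] : TopologicalSpace G :=
  TopologicalSpace.generateFrom (finiteIndexNormalCosets G)

/-- The cosets of the finite index normal subgroups are a basis of the profinite topology, not
only a subbasis. -/
theorem isTopologicalBasis_finiteIndexNormalCosets (G : Type u) [Group G] :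
    @TopologicalSpace.IsTopologicalBasis G (profiniteTopology G) (finiteIndexNormalCosets G) := by
  let _ : TopologicalSpace G := profiniteTopology G
  refine ⟨?_, ?_, rfl⟩
  · rintro _ ⟨N, g, hN, hNf, rfl⟩ _ ⟨M, k, hM, hMf, rfl⟩ x ⟨hx, hx'⟩
    refine ⟨x • ((N ⊓ M : Subgroup G) : Set G),
      ⟨N ⊓ M, x, inferInstance, inferInstance, rfl⟩, ?_, ?_⟩
    · exact ⟨1, one_mem _, by simp⟩
    · rintro _ ⟨y, ⟨hyN, hyM⟩, rfl⟩
      rw [mem_leftCoset_iff] at hx hx'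
      constructor
      · rw [mem_leftCoset_iff]
        simpa [mul_assoc] using N.mul_mem hx hyN
      · rw [mem_leftCoset_iff]
        simpa [mul_assoc] using M.mul_mem hx' hyM
  · refine Set.eq_univ_of_forall fun x => ⟨(x • ((⊤ : Subgroup G) : Set G)), ?_, ?_⟩
    · exact ⟨⊤, x, inferInstance, inferInstance, rfl⟩
    · exact ⟨1, one_mem _, by simp⟩

/-- A group is ERF (extended residually finite) if each of its subgroups, finitely generated or
not, is closed in the profinite topology. -/
def IsERF (G : Type u) [Group G] : Prop :=
  ∀ H : Subgroup G, @IsClosed G (profiniteTopology G) (H : Set G)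

/-- A (multiplicatively written) group is free abelian if it is isomorphic to the free abelian
group on some set. -/
def IsFreeAbelian (G : Type u) [Group G] : Prop :=
  ∃ ι : Type u, Nonempty (G ≃* Multiplicative (FreeAbelianGroup ι))

/-! The substance is 1 → 2. The Artin group acts on `V → ℂ` by transvections with weights `2i cos (π
/ m)`, and `2i`, the limit `m → ∞`, for non-adjacent pairs. A Chebyshev identity makes the Artin
relations hold (`altProd_comm_of_transvections`). If `a ≠ b` are not joined by an edge of label `2`,
their weight has norm at least `1`, and ping-pong shows that the squares of the two generators
generate a free group of rank two (`lift_zpowersHom_sq_injective`). Such a free group has a subgroup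
that is not closed even in the ambient group (`not_isERF_of_injective`).

For 2 → 3 the relations say exactly that the generators commute. For 3 → 1 the group is finitely
generated abelian, so its quotient by any subgroup is residually finite (`CommGroup.isERF_of_fg`).
-/

open Monoid (CoprodI)

/-! ### Subgroup separability -/

/-- A group is ERF iff each element outside a subgroup `H` has a coset of a finite index normal
subgroup which misses `H`. -/
theorem isERF_iff {G : Type u} [Group G] :
    IsERF G ↔ ∀ (H : Subgroup G) (g : G), g ∉ H →
      ∃ N : Subgroup G, N.Normal ∧ N.FiniteIndex ∧ ∀ n ∈ N, g * n ∉ H := by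
  let _ : TopologicalSpace G := profiniteTopology G
  refine forall_congr' fun H => ?_
  rw [← isOpen_compl_iff, (isTopologicalBasis_finiteIndexNormalCosets G).isOpen_iff]
  refine forall_congr' fun g => imp_congr_right fun _ => ⟨?_, ?_⟩
  · rintro ⟨_, ⟨N, k, hN, hNf, rfl⟩, hg, hsub⟩
    refine ⟨N, hN, hNf, fun n hn => hsub ?_⟩
    rw [mem_leftCoset_iff] at hg ⊢
    rw [← mul_assoc]
    exact N.mul_mem hg hn
  · rintro ⟨N, hN, hNf, h⟩
    refine ⟨g • (N : Set G), ⟨N, g, hN, hNf, rfl⟩, ⟨1, one_mem _, by simp⟩, ?_⟩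
    rintro _ ⟨n, hn, rfl⟩
    exact h n hn

/-- Finitely generated abelian groups are residually finite. -/
theorem CommGroup.residuallyFinite_of_fg (G : Type*) [CommGroup G] [Group.FG G] :
    Group.ResiduallyFinite G := by
  obtain ⟨ι, j, _, _, p, hp, e, ⟨φ⟩⟩ := CommGroup.equiv_free_prod_prod_multiplicative_zmod G
  rw [Group.residuallyFinite_iff_exists_finiteIndex]
  intro g hg
  have hφ : φ g ≠ 1 := by simpa using hg
  by_cases h1 : (φ g).1 = 1
  · have h2 : (φ g).2 ≠ 1 := fun h2 => hφ (Prod.ext h1 h2)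
    have : ∀ i, NeZero (p i ^ e i) := fun i => ⟨pow_ne_zero _ (hp i).ne_zero⟩
    have : ∀ i, Finite (Multiplicative (ZMod (p i ^ e i))) := fun i =>
      inferInstanceAs (Finite (ZMod (p i ^ e i)))
    refine ⟨((MonoidHom.snd _ _).comp φ.toMonoidHom).ker, Subgroup.finiteIndex_ker _, ?_⟩
    exact fun hmem => h2 hmem
  · obtain ⟨i, hi⟩ := Function.ne_iff.1 h1
    set k : ℤ := ((φ g).1 i).toAdd with hk
    have hk0 : k ≠ 0 := fun h => hi (Multiplicative.toAdd.injective h)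
    -- The modulus `|k| + 1` exceeds `|k|`, so it cannot divide `k ≠ 0`.
    let ψ : G →* Multiplicative (ZMod (k.natAbs + 1)) :=
      (Int.castAddHom (ZMod (k.natAbs + 1))).toMultiplicative.comp
        ((Pi.evalMonoidHom _ i).comp ((MonoidHom.fst _ _).comp φ.toMonoidHom))
    have : Finite (Multiplicative (ZMod (k.natAbs + 1))) :=
      inferInstanceAs (Finite (ZMod (k.natAbs + 1)))
    refine ⟨ψ.ker, Subgroup.finiteIndex_ker _, fun hmem => ?_⟩
    have hz : (k : ZMod (k.natAbs + 1)) = 0 := hmem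
    rw [ZMod.intCast_zmod_eq_zero_iff_dvd] at hz
    have := Int.le_of_dvd (abs_pos.2 hk0) ((dvd_abs _ _).2 hz)
    push_cast at this
    omega

/-- Finitely generated abelian groups are ERF. -/
theorem CommGroup.isERF_of_fg (G : Type u) [CommGroup G] [Group.FG G] : IsERF G := by
  rw [isERF_iff]
  intro H g hg
  have := CommGroup.residuallyFinite_of_fg (G ⧸ H)
  obtain ⟨N, hN⟩ := Group.exists_finiteIndexNormalSubgroup_notMem (g : G ⧸ H)
    (by rwa [Ne, QuotientGroup.eq_one_iff])
  have : (N.toSubgroup.comap (QuotientGroup.mk' H)).FiniteIndex :=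
    (N.comap (QuotientGroup.mk' H)).isFiniteIndex'
  refine ⟨N.toSubgroup.comap (QuotientGroup.mk' H), inferInstance, this, ?_⟩
  intro n hn hgn
  apply hN
  have h1 : (g : G ⧸ H) * (n : G ⧸ H) = 1 := by
    rwa [← QuotientGroup.mk_mul, QuotientGroup.eq_one_iff]
  rw [eq_inv_of_mul_eq_one_left h1]
  exact N.toSubgroup.inv_mem hn

/-- A group containing a free product of two infinite cyclic groups is not ERF: if `x` and `y`
generate the factors, then `y` is in the closure of the subgroup generated by the conjugates
`x ^ n * y * x ^ (-n)` with `n > 0`. -/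
theorem not_isERF_of_injective {G : Type u} [Group G]
    (f : CoprodI (fun _ : Bool => Multiplicative ℤ) →* G) (hf : Function.Injective f) :
    ¬ IsERF G := by
  intro h
  rw [isERF_iff] at h
  set x : CoprodI (fun _ : Bool => Multiplicative ℤ) :=
    CoprodI.of (i := false) (Multiplicative.ofAdd (1 : ℤ)) with hx
  set y : CoprodI (fun _ : Bool => Multiplicative ℤ) :=
    CoprodI.of (i := true) (Multiplicative.ofAdd (1 : ℤ)) with hy
  set H := Subgroup.closure {z | ∃ n : ℕ, 0 < n ∧ z = x ^ n * y * (x ^ n)⁻¹} with hH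
  -- With `x` the shift and `y` the swap of `0` and `1`, the conjugate `x ^ n * y * x ^ (-n)` swaps
  -- `n` and `n + 1`. It fixes `0` for `n > 0`, whereas `y` moves `0`.
  let ψ : CoprodI (fun _ : Bool => Multiplicative ℤ) →* Equiv.Perm ℤ :=
    CoprodI.lift fun i => zpowersHom (Equiv.Perm ℤ) (cond i (Equiv.swap 0 1) (Equiv.addRight 1))
  have hψx : ψ x = Equiv.addRight 1 := by simp [ψ, hx]
  have hψy : ψ y = Equiv.swap 0 1 := by simp [ψ, hy]
  have hHψ : H ≤ (MulAction.stabilizer (Equiv.Perm ℤ) (0 : ℤ)).comap ψ := by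
    rw [hH, Subgroup.closure_le]
    rintro _ ⟨n, hn, rfl⟩
    have hpow : (Equiv.addRight (1 : ℤ)) ^ n = Equiv.addRight (n : ℤ) := by
      ext k
      simp
    have hfix : Equiv.swap (0 : ℤ) 1 (-n) = -n :=
      Equiv.swap_apply_of_ne_of_ne (by omega) (by omega)
    simp [MulAction.mem_stabilizer_iff, hψx, hψy, hpow, Equiv.Perm.smul_def, hfix]
  have hyH : y ∉ H := fun hmem => by
    have := hHψ hmem
    simp [MulAction.mem_stabilizer_iff, hψy, Equiv.Perm.smul_def] at this
  have hfy : f y ∉ H.map f := fun hmem => by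
    obtain ⟨z, hz, hzy⟩ := hmem
    exact hyH (hf hzy ▸ hz)
  obtain ⟨N, hN, hNf, hsep⟩ := h (H.map f) (f y) hfy
  obtain ⟨n, hn0, -, hn⟩ := Subgroup.exists_pow_mem_of_index_ne_zero hNf.index_ne_zero (f x)
  -- This commutator lies in `N` because `f x ^ n` does, and it carries `f y` to a conjugate lying
  -- in the image of `H`.
  refine hsep ((f y)⁻¹ * f x ^ n * f y * (f x ^ n)⁻¹)
    (N.mul_mem (by simpa using hN.conj_mem _ hn (f y)⁻¹) (N.inv_mem hn)) ?_
  have : f y * ((f y)⁻¹ * f x ^ n * f y * (f x ^ n)⁻¹) = f (x ^ n * y * (x ^ n)⁻¹) := by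
    simp [mul_assoc]
  rw [this]
  exact ⟨_, Subgroup.subset_closure ⟨n, hn0, rfl⟩, rfl⟩

/-! ### Alternating products -/

theorem map_altProd {G H : Type u} [Group G] [Group H] (f : G →* H) (a b : G) (n : ℕ) :
    f (altProd a b n) = altProd (f a) (f b) n := by
  induction n generalizing a b with
  | zero => simp [altProd]
  | succ n ih => simp [altProd, ih]

/-- The recurrence `w (n + 2) = w n + μ w (n + 1)` with `w 0 = 0` and `w 1 = 1`. -/
def fibWeight (μ : ℂ) : ℕ → ℂ
  | 0 => 0
  | 1 => 1
  | n + 2 => fibWeight μ n + μ * fibWeight μ (n + 1)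

/-- These are Chebyshev polynomials of the second kind: the twist by `ε`, with `ε ^ 2 = -1`, turns
the minus sign of their recurrence into a plus. -/
theorem fibWeight_mul_sin (ε θ : ℂ) (hε : ε ^ 2 = -1) (n : ℕ) :
    fibWeight (ε * (2 * Complex.cos θ)) n * Complex.sin θ * ε = ε ^ n * Complex.sin (n * θ) := by
  induction n using Nat.twoStepInduction with
  | zero => simp [fibWeight]
  | one => simp [fibWeight, mul_comm]
  | more n ih1 ih2 =>
    have h1 : Complex.sin (((n + 2 : ℕ) : ℂ) * θ) =
        2 * Complex.cos θ * Complex.sin (((n + 1 : ℕ) : ℂ) * θ) - Complex.sin (n * θ) := by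
      have e1 : ((n + 2 : ℕ) : ℂ) * θ = ((n + 1 : ℕ) : ℂ) * θ + θ := by push_cast; ring
      have e2 : (n : ℂ) * θ = ((n + 1 : ℕ) : ℂ) * θ - θ := by push_cast; ring
      rw [e1, e2, Complex.sin_add, Complex.sin_sub]
      ring
    rw [h1, fibWeight]
    linear_combination ih1 + ε * (2 * Complex.cos θ) * ih2 + ε ^ n * Complex.sin (n * θ) * hε

theorem fibWeight_eq_zero (ε : ℂ) (hε : ε ^ 2 = -1) (m : ℕ) (hm : 1 < m) :
    fibWeight (ε * (2 * Real.cos (Real.pi / m) : ℝ)) m = 0 := by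
  have h := fibWeight_mul_sin ε ((Real.pi / m : ℝ) : ℂ) hε m
  have hm0 : (m : ℂ) ≠ 0 := by exact_mod_cast (by omega : m ≠ 0)
  have hmul : (m : ℂ) * ((Real.pi / m : ℝ) : ℂ) = Real.pi := by
    push_cast
    field_simp
  have hsin : Complex.sin ((Real.pi / m : ℝ) : ℂ) ≠ 0 := by
    rw [← Complex.ofReal_sin]
    have hm1 : (1 : ℝ) < m := by exact_mod_cast hm
    exact_mod_cast (Real.sin_pos_of_pos_of_lt_pi (by positivity)
      (div_lt_self Real.pi_pos hm1)).ne'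
  have hε0 : ε ≠ 0 := by
    rintro rfl
    norm_num at hε
  rw [hmul, Complex.sin_pi, mul_zero] at h
  have h' := (mul_eq_zero.1 ((mul_eq_zero.1 h).resolve_right hε0)).resolve_right hsin
  simpa using h'

/-- An alternating product of `1 + E` and `1 + F`, where `E` and `F` satisfy relations of
Temperley-Lieb type. -/
theorem exists_altProd_eq {R : Type u} [Ring R] [Algebra ℂ R] (S T : Rˣ) (E F : R) (μ : ℂ)
    (hS : (S : R) = 1 + E) (hT : (T : R) = 1 + F) (hEE : E * E = 0) (hFF : F * F = 0)
    (hEFE : E * (F * E) = μ ^ 2 • E) (hFEF : F * (E * F) = μ ^ 2 • F) (n : ℕ) :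
    ∃ a b c d : ℂ,
      ((altProd S T n : Rˣ) : R) = 1 + a • E + b • F + c • (E * F) + d • (F * E) ∧
      ((altProd T S n : Rˣ) : R) = 1 + b • E + a • F + d • (E * F) + c • (F * E) ∧
      (a - b) + μ * (c - d) = fibWeight μ n ∧
      (b + 1 + μ ^ 2 * c - a) + μ * (d + a - c) = fibWeight μ (n + 1) ∧
      (a - b) - μ * (c - d) = fibWeight (-μ) n ∧
      (b + 1 + μ ^ 2 * c - a) - μ * (d + a - c) = fibWeight (-μ) (n + 1) := by
  induction n with
  | zero => exact ⟨0, 0, 0, 0, by simp [altProd, fibWeight]⟩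
  | succ n ih =>
    obtain ⟨a, b, c, d, hp, hq, h1, h2, h3, h4⟩ := ih
    have hEEF : E * (E * F) = 0 := by rw [← mul_assoc, hEE, zero_mul]
    have hFFE : F * (F * E) = 0 := by rw [← mul_assoc, hFF, zero_mul]
    -- These are the coefficients after left multiplication by `1 + E`. The recurrence has order
    -- two, so the induction carries the values at both `n` and `n + 1`.
    refine ⟨b + 1 + μ ^ 2 * c, a, d + a, c, ?_, ?_, ?_, ?_, ?_, ?_⟩
    · simp only [altProd, Units.val_mul, hq, hS, add_mul, mul_add, one_mul, mul_one,
        mul_smul_comm, hEE, hEEF, hEFE]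
      module
    · simp only [altProd, Units.val_mul, hp, hT, add_mul, mul_add, one_mul, mul_one,
        mul_smul_comm, hFF, hFFE, hFEF]
      module
    · linear_combination h2
    · rw [fibWeight]
      linear_combination h1 + μ * h2
    · linear_combination h4
    · rw [fibWeight]
      linear_combination h3 - μ * h4

/-- Vanishing of `fibWeight` at `μ` and `-μ` gives `a = b` but only `μ * c = μ * d`. As `μ = 0` when
`m = 2`, the factor `μ` in `hX` and `hY` is needed to conclude. -/
theorem altProd_comm_of_transvections {R : Type u} [Ring R] [Algebra ℂ R] (S T : Rˣ)
    (E F X Y : R) (m : ℕ) (hm : 1 < m) (μ : ℂ)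
    (hμ : μ = Complex.I * (2 * Real.cos (Real.pi / m) : ℝ))
    (hS : (S : R) = 1 + E) (hT : (T : R) = 1 + F) (hEE : E * E = 0) (hFF : F * F = 0)
    (hEFE : E * (F * E) = μ ^ 2 • E) (hFEF : F * (E * F) = μ ^ 2 • F)
    (hX : E * F = μ • X) (hY : F * E = μ • Y) :
    altProd S T m = altProd T S m := by
  obtain ⟨a, b, c, d, hp, hq, h1, -, h3, -⟩ :=
    exists_altProd_eq S T E F μ hS hT hEE hFF hEFE hFEF m
  rw [hμ, fibWeight_eq_zero _ Complex.I_sq m hm, ← hμ] at h1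
  rw [hμ, ← neg_mul, fibWeight_eq_zero _ (by simp) m hm, ← hμ] at h3
  have hab : a = b := by linear_combination (h1 + h3) / 2
  have hcd : μ * c = μ * d := by linear_combination (h1 - h3) / 2
  ext
  rw [hp, hq, hX, hY, hab]
  simp only [smul_smul, mul_comm _ μ, hcd]

/-! ### Transvections -/

section Transvection

variable {V : Type u}

/-- The rank one endomorphism `f ↦ f s • b` of the space of complex functions. -/
def rankOne (b : V → ℂ) (s : V) : Module.End ℂ (V → ℂ) :=
  (LinearMap.proj s).smulRight b

theorem rankOne_apply (b : V → ℂ) (s : V) (f : V → ℂ) : rankOne b s f = f s • b := rfl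

theorem rankOne_mul (b c : V → ℂ) (s t : V) :
    rankOne b s * rankOne c t = c s • rankOne b t := by
  ext1 f
  simp [rankOne_apply, smul_smul, mul_comm]

/-- The one parameter group of transvections `f ↦ f + z • f s • b`, for `b s = 0`. -/
def transvectionHom (b : V → ℂ) (s : V) (hb : b s = 0) :
    Multiplicative ℂ →* (Module.End ℂ (V → ℂ))ˣ :=
  MonoidHom.toHomUnits
    { toFun := fun z => 1 + z.toAdd • rankOne b s
      map_one' := by simp
      map_mul' := fun z w => by
        simp only [toAdd_mul, add_mul, mul_add, one_mul, mul_one, smul_mul_smul_comm, rankOne_mul,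
          hb, zero_smul, smul_zero, add_smul]
        abel }

theorem coe_transvectionHom (b : V → ℂ) (s : V) (hb : b s = 0) (z : ℂ) :
    (transvectionHom b s hb (Multiplicative.ofAdd z) : Module.End ℂ (V → ℂ)) =
      1 + z • rankOne b s := rfl

theorem transvectionHom_smul (b : V → ℂ) (s : V) (hb : b s = 0) (z : ℂ) (f : V → ℂ) (t : V) :
    (transvectionHom b s hb (Multiplicative.ofAdd z) • f) t = f t + z * (f s * b t) := rfl

/-- Squares of transvections with entries of norm at least `1` generate a free group. -/
theorem lift_zpowersHom_sq_injective (b : V → V → ℂ) (hb : ∀ s, b s s = 0) (c : Bool → V)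
    (hc : c false ≠ c true) (hb1 : ∀ i, 1 ≤ ‖b (c i) (c !i)‖) :
    Function.Injective (CoprodI.lift fun i : Bool =>
      zpowersHom (Module.End ℂ (V → ℂ))ˣ
        (transvectionHom (b (c i)) (c i) (hb _) (Multiplicative.ofAdd 1) ^ 2)) := by
  classical
  have hc' : ∀ i : Bool, c i ≠ c !i := by
    rintro (_ | _)
    exacts [hc, hc.symm]
  refine CoprodI.lift_injective_of_ping_pong _
    -- Ping-pong with only two factors requires one of them to have at least three elements.
    (Or.inr ⟨true, le_trans (Cardinal.natCast_lt_aleph0 (n := 3)).le (Cardinal.aleph0_le_mk _)⟩)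
    (fun i : Bool => {f : V → ℂ | ‖f (c i)‖ < ‖f (c !i)‖}) ?_ ?_ ?_
  · intro i
    refine ⟨Pi.single (c !i) 1, ?_⟩
    simp [hc' i]
  · intro i j hij
    obtain rfl : j = !i := by cases i <;> cases j <;> simp_all
    rw [Function.onFun, Set.disjoint_left]
    intro f h1 h2
    simp only [Set.mem_ofPred_eq, Bool.not_not] at h1 h2
    exact lt_asymm h1 h2
  · intro i j hij k hk
    obtain rfl : j = !i := by cases i <;> cases j <;> simp_all
    rintro _ ⟨f, hf, rfl⟩
    have hk0 : k.toAdd ≠ 0 := fun h => hk (Multiplicative.toAdd.injective h)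
    have hpow : zpowersHom (Module.End ℂ (V → ℂ))ˣ
        (transvectionHom (b (c i)) (c i) (hb _) (Multiplicative.ofAdd 1) ^ 2) k =
        transvectionHom (b (c i)) (c i) (hb _) (Multiplicative.ofAdd (2 * (k.toAdd : ℂ))) := by
      rw [zpowersHom_apply, ← map_pow, ← map_zpow, ← ofAdd_nsmul, ← ofAdd_zsmul]
      congr 2
      simp [mul_comm]
    simp only [Set.mem_ofPred_eq, Bool.not_not] at hf
    simp only [Set.mem_ofPred_eq, hpow, transvectionHom_smul, hb, mul_zero, add_zero]
    have hk1 : (1 : ℝ) ≤ ‖(k.toAdd : ℂ)‖ := by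
      rw [Complex.norm_intCast]
      exact_mod_cast Int.one_le_abs hk0
    -- The factor `2` comes from squaring: the new coordinate at `c !i` has norm at least `2 * ‖f (c
    -- i)‖ - ‖f (c !i)‖ > ‖f (c i)‖`.
    have hnorm : 2 * ‖f (c i)‖ ≤ ‖2 * (k.toAdd : ℂ) * (f (c i) * b (c i) (c !i))‖ := by
      rw [norm_mul, norm_mul, norm_mul, Complex.norm_ofNat]
      have h1 : 1 ≤ ‖(k.toAdd : ℂ)‖ * ‖b (c i) (c !i)‖ := one_le_mul_of_one_le_of_one_le hk1 (hb1 i)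
      nlinarith [norm_nonneg (f (c i))]
    have htri := norm_sub_norm_le (2 * (k.toAdd : ℂ) * (f (c i) * b (c i) (c !i))) (-f (c !i))
    rw [sub_neg_eq_add, norm_neg, add_comm (2 * (k.toAdd : ℂ) * _)] at htri
    linarith

end Transvection

/-! ### Artin groups -/

namespace ArtinGraph

variable {V : Type u} (Γ : ArtinGraph V)

theorem one_lt_get (a b : V) (h : Γ.graph.Adj a b) : 1 < Γ.label.get a b h :=
  Γ.one_lt_label _

theorem altProd_of_eq (a b : V) (h : Γ.graph.Adj a b) :
    altProd (PresentedGroup.of a : Γ.ArtinGroup) (PresentedGroup.of b) (Γ.label.get a b h) =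
      altProd (PresentedGroup.of b) (PresentedGroup.of a) (Γ.label.get a b h) := by
  have h1 := PresentedGroup.one_of_mem (rels := Γ.relators) ⟨a, b, h, rfl⟩
  rw [map_mul, map_inv, mul_inv_eq_one, map_altProd, map_altProd] at h1
  exact h1

/-- The homomorphism out of the Artin group given by a family which satisfies the relations. -/
def liftHom {G : Type u} [Group G] (x : V → G)
    (hx : ∀ (a b : V) (h : Γ.graph.Adj a b),
      altProd (x a) (x b) (Γ.label.get a b h) = altProd (x b) (x a) (Γ.label.get a b h)) :
    Γ.ArtinGroup →* G :=
  PresentedGroup.toGroup (f := x) (by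
    rintro _ ⟨a, b, h, rfl⟩
    rw [map_mul, map_inv, mul_inv_eq_one, map_altProd, map_altProd]
    simpa using hx a b h)

@[simp]
theorem liftHom_of {G : Type u} [Group G] (x : V → G) (hx) (a : V) :
    Γ.liftHom x hx (PresentedGroup.of a) = x a :=
  PresentedGroup.toGroup.of _

open Classical in
/-- The weights `2 cos (π / m)` of the edges, with `2` for pairs of vertices which are not
adjacent and `0` on the diagonal, times the imaginary unit. -/
noncomputable def weight (a b : V) : ℂ :=
  if a = b then 0 else
    if h : Γ.graph.Adj a b then
      Complex.I * (2 * Real.cos (Real.pi / Γ.label.get a b h) : ℝ)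
    else Complex.I * 2

theorem weight_self (a : V) : Γ.weight a a = 0 := by simp [weight]

theorem weight_of_adj (a b : V) (h : Γ.graph.Adj a b) :
    Γ.weight a b = Complex.I * (2 * Real.cos (Real.pi / Γ.label.get a b h) : ℝ) := by
  rw [weight, if_neg h.ne, dif_pos h]

theorem weight_comm (a b : V) : Γ.weight a b = Γ.weight b a := by
  by_cases hab : a = b
  · rw [hab]
  · by_cases h : Γ.graph.Adj a b
    · rw [weight_of_adj _ _ _ h, weight_of_adj _ _ _ h.symm, SimpleGraph.EdgeLabeling.get_comm]
    · have h' : ¬ Γ.graph.Adj b a := fun h' => h h'.symm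
      simp [weight, hab, Ne.symm hab, h, h']

theorem one_le_norm_weight (a b : V) (hab : a ≠ b)
    (h : ∀ h : Γ.graph.Adj a b, Γ.label.get a b h ≠ 2) : 1 ≤ ‖Γ.weight a b‖ := by
  by_cases hadj : Γ.graph.Adj a b
  · rw [weight_of_adj _ _ _ hadj, norm_mul, Complex.norm_I, one_mul, Complex.norm_real]
    refine le_trans ?_ (le_abs_self _)
    have hm : 3 ≤ Γ.label.get a b hadj := by
      have := Γ.one_lt_get a b hadj
      have := h hadj
      omega
    have hm' : (3 : ℝ) ≤ Γ.label.get a b hadj := by exact_mod_cast hm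
    have hcos := Real.cos_le_cos_of_nonneg_of_le_pi (x := Real.pi / Γ.label.get a b hadj)
      (y := Real.pi / 3) (by positivity) (by linarith [Real.pi_pos])
      (div_le_div_of_nonneg_left Real.pi_pos.le (by norm_num) hm')
    rw [Real.cos_pi_div_three] at hcos
    linarith
  · simp [weight, hab, hadj]

/-- The representation of the Artin group by complex transvections. -/
noncomputable def transvectionRep : Γ.ArtinGroup →* (Module.End ℂ (V → ℂ))ˣ :=
  Γ.liftHom
    (fun a => transvectionHom (Γ.weight a) a (Γ.weight_self a) (Multiplicative.ofAdd 1)) (by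
      intro a b h
      refine altProd_comm_of_transvections _ _ (rankOne (Γ.weight a) a) (rankOne (Γ.weight b) b)
        (rankOne (Γ.weight a) b) (rankOne (Γ.weight b) a) _ (Γ.one_lt_get a b h) (Γ.weight a b)
        (Γ.weight_of_adj a b h) ?_ ?_ ?_ ?_ ?_ ?_ ?_ ?_
      · rw [coe_transvectionHom, one_smul]
      · rw [coe_transvectionHom, one_smul]
      · rw [rankOne_mul, weight_self, zero_smul]
      · rw [rankOne_mul, weight_self, zero_smul]
      · rw [rankOne_mul, mul_smul_comm, rankOne_mul, smul_smul, Γ.weight_comm b a, sq]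
      · rw [rankOne_mul, mul_smul_comm, rankOne_mul, smul_smul, Γ.weight_comm b a, sq]
      · rw [rankOne_mul, Γ.weight_comm b a]
      · rw [rankOne_mul])

/-- If two distinct vertices are not joined by an edge of label `2`, then the Artin group contains
a free group of rank two, and thus is not ERF. -/
theorem not_isERF (a b : V) (hab : a ≠ b) (h : ∀ h : Γ.graph.Adj a b, Γ.label.get a b h ≠ 2) :
    ¬ IsERF Γ.ArtinGroup := by
  let c : Bool → V := fun i => cond i b a
  let f : CoprodI (fun _ : Bool => Multiplicative ℤ) →* Γ.ArtinGroup :=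
    CoprodI.lift fun i => zpowersHom _ (PresentedGroup.of (c i) ^ 2)
  have hw := Γ.one_le_norm_weight a b hab h
  have hinj := lift_zpowersHom_sq_injective Γ.weight Γ.weight_self c hab (by
    rintro (_ | _)
    exacts [hw, Γ.weight_comm a b ▸ hw])
  refine not_isERF_of_injective f (Function.Injective.of_comp (f := Γ.transvectionRep) ?_)
  rw [← MonoidHom.coe_comp]
  convert hinj using 2
  refine CoprodI.ext_hom _ _ fun i => ?_
  ext
  simp [f, transvectionRep]

theorem isCompleteTwo_of_isERF (h : IsERF Γ.ArtinGroup) : Γ.IsCompleteTwo := by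
  have key : ∀ a b, a ≠ b → ∃ h : Γ.graph.Adj a b, Γ.label.get a b h = 2 := fun a b hab => by
    by_contra! hne
    exact Γ.not_isERF a b hab hne h
  constructor
  · ext a b
    exact ⟨fun hadj => hadj.ne, fun hab => (key a b hab).1⟩
  · rintro ⟨e, he⟩
    induction e using Sym2.inductionOn with
    | _ a b => exact (key a b (SimpleGraph.Adj.ne he)).2

theorem isFreeAbelian_of_isCompleteTwo (h : Γ.IsCompleteTwo) : IsFreeAbelian Γ.ArtinGroup := by
  obtain ⟨htop, htwo⟩ := h
  have hcomm : ∀ a b : V, Commute (PresentedGroup.of a : Γ.ArtinGroup) (PresentedGroup.of b) := by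
    intro a b
    by_cases hab : a = b
    · rw [hab]
    · have hadj : Γ.graph.Adj a b := by rwa [htop]
      have h1 := Γ.altProd_of_eq a b hadj
      rw [show Γ.label.get a b hadj = 2 from htwo _] at h1
      simpa [altProd, Commute, SemiconjBy] using h1
  let _ : CommGroup Γ.ArtinGroup :=
    { (inferInstance : Group Γ.ArtinGroup) with
      mul_comm := by
        have hcl := PresentedGroup.closure_range_of Γ.relators
        intro x y
        have hx : x ∈ Subgroup.closure (Set.range (PresentedGroup.of (rels := Γ.relators))) :=
          hcl ▸ Subgroup.mem_top x
        have hy : y ∈ Subgroup.closure (Set.range (PresentedGroup.of (rels := Γ.relators))) :=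
          hcl ▸ Subgroup.mem_top y
        induction hx, hy using Subgroup.closure_induction₂ with
        | mem x y hx hy =>
          obtain ⟨a, rfl⟩ := hx
          obtain ⟨b, rfl⟩ := hy
          exact hcomm a b
        | one_left x hx => exact Commute.one_left x
        | one_right x hx => exact Commute.one_right x
        | mul_left x y z _ _ _ h1 h2 => exact Commute.mul_left h1 h2
        | mul_right x y z _ _ _ h1 h2 => exact Commute.mul_right h1 h2
        | inv_left x y _ _ h1 => exact Commute.inv_left h1
        | inv_right x y _ _ h1 => exact Commute.inv_right h1 }
  let F : Γ.ArtinGroup →* Multiplicative (FreeAbelianGroup V) :=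
    Γ.liftHom (fun a => Multiplicative.ofAdd (FreeAbelianGroup.of a)) (by
      intro a b hadj
      rw [show Γ.label.get a b hadj = 2 from htwo _]
      simp [altProd, mul_comm])
  let K : Multiplicative (FreeAbelianGroup V) →* Γ.ArtinGroup :=
    AddMonoidHom.toMultiplicativeLeft
      (FreeAbelianGroup.lift fun a => Additive.ofMul (PresentedGroup.of a : Γ.ArtinGroup))
  have hK : ∀ a, K (Multiplicative.ofAdd (FreeAbelianGroup.of a)) = PresentedGroup.of a :=
    fun a => congrArg Additive.toMul (FreeAbelianGroup.lift_apply_of _ a)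
  refine ⟨V, ⟨MonoidHom.toMulEquiv F K ?_ ?_⟩⟩
  · refine PresentedGroup.ext fun a => ?_
    simp [F, hK]
  · refine MonoidHom.toAdditive.injective (FreeAbelianGroup.lift_ext _ _ fun a => ?_)
    exact congrArg Additive.ofMul ((congrArg F (hK a)).trans (Γ.liftHom_of _ _ a))

/-- Finiteness of `V` matters here: free abelian groups of infinite rank are not ERF, since they
have quotients, such as `ℚ`, that are not residually finite. -/
theorem isERF_of_isFreeAbelian [Finite V] (h : IsFreeAbelian Γ.ArtinGroup) :
    IsERF Γ.ArtinGroup := by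
  obtain ⟨ι, ⟨φ⟩⟩ := h
  let _ : CommGroup Γ.ArtinGroup :=
    { (inferInstance : Group Γ.ArtinGroup) with
      mul_comm := fun x y => φ.injective (by rw [map_mul, map_mul, mul_comm]) }
  have : Group.FG Γ.ArtinGroup := Group.fg_iff.2
    ⟨_, PresentedGroup.closure_range_of Γ.relators, Set.finite_range _⟩
  exact CommGroup.isERF_of_fg _

end ArtinGraph

theorem theorem1p3 {V : Type u} [Finite V] (Γ : ArtinGraph V) :
    List.TFAE [IsERF Γ.ArtinGroup, Γ.IsCompleteTwo, IsFreeAbelian Γ.ArtinGroup] := by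
  tfae_have 1 → 2 := Γ.isCompleteTwo_of_isERF
  tfae_have 2 → 3 := Γ.isFreeAbelian_of_isCompleteTwo
  tfae_have 3 → 1 := Γ.isERF_of_isFreeAbelian
  tfae_finish
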